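/- Let $\mathbb Z_+=\{0,1,2,\dots\}$ and let $S=\mathbb Z_+\times\mathbb Z$ be the (discrete, countable) semigroup with coordinatewise addition. Let $\ell^1(S)$ be the complex convolution algebra of $S$, with $\delta_s*\delta_t=\delta_{s+t}$, and identify $\ell^1(S)^*$ with $\ell^\infty(S)$. A *predual* of $\ell^1(S)$ is a closed $\ell^1(S)$-submodule $E\subseteq\ell^1(S)^*$ for which the canonical map $\ell^1(S)\to E^*$, $a\mapsto(f\mapsto\langle f,a\rangle)$, is a linear isomorphism of Banach spaces. It is a *Hopf algebra predual* if, in addition, the coproduct $\Gamma:\ell^1(S)\to\ell^1(S\times S)$, $\Gamma(\delta_s)=\delta_{(s,s)}$, is weak*-continuous, where the weak* topologies are those induced by $E$ and by the closed linear span of $\{f\otimes g: f,g\in E\}$ in $\ell^\infty(S\times S)$; equivalently, if $E$ is a subalgebra of $\ell^\infty(S)$. For $n\ge 1$ let $w_n=2^{2^n}$. For a sequence of integers $1\le m_1<m_2<\cdots$, let $\sigma_{(m_i)}$ be the topology on $S$ generated by the sets $$U_{a,s,\alpha}=\Big\{\Big(a-k,\ s+\sum_{j=1}^k w_{m_{i_j}}\Big):\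 0\le k\le a,\ \alpha\le i_1<\cdots<i_k\Big\}\qquad (a\in\mathbb Z_+,\ s\in\mathbb Z,\ \alpha\in\mathbb N).$$ **Theorem.** There exist a continuum of Hopf algebra preduals for $\ell^1(\mathbb Z_+\times\mathbb Z)$. More precisely: 1. For every sequence $1\le m_1<m_2<\cdots$, the sets $U_{a,s,\alpha}$ form a base of $\sigma_{(m_i)}$; the topology $\sigma_{(m_i)}$ is Hausdorff, locally compact and not discrete; it makes $S$ a semitopological semigroup (the operation is separately continuous); and $C_0(S,\sigma_{(m_i)})\subseteq\ell^\infty(S)$ is a Hopf algebra predual of $\ell^1(S)$. 2. The set $\{C_0(S,\sigma_{(m_i)}):\ 1\le m_1<m_2<\cdots\}$ of subspaces of $\ell^\infty(S)$ has cardinality $2^{\aleph_0}$. -/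

import Mathlib

open Filter Topology Set
open scoped lp ENNReal

noncomputable section

namespace SemigroupPredual

/-! ### The Banach space `ℓ¹(S)` -/

/-- The standard unit vector `δ_s` of `ℓ¹(S)`. -/
def delta {S : Type*} [DecidableEq S] (s : S) : ℓ¹(S, ℂ) := lp.single 1 s (1 : ℂ)

theorem l1_summable_norm {S : Type*} (a : ℓ¹(S, ℂ)) : Summable fun s => ‖a s‖ := by
  simpa using a.2.summable

theorem l1_norm_eq {S : Type*} (a : ℓ¹(S, ℂ)) : ‖a‖ = ∑' s, ‖a s‖ := by
  rw [lp.norm_eq_tsum_rpow (by simp)]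
  simp

theorem l1_summable_smul {S X : Type*} [NormedAddCommGroup X] [NormedSpace ℂ X] [CompleteSpace X]
    (v : S → X) (C : ℝ) (hv : ∀ s, ‖v s‖ ≤ C) (a : ℓ¹(S, ℂ)) : Summable fun s => a s • v s :=
  Summable.of_norm_bounded ((l1_summable_norm a).mul_right C) fun s => by
    rw [norm_smul]
    exact mul_le_mul_of_nonneg_left (hv s) (norm_nonneg _)

/-- The bounded linear map `ℓ¹(S) → X`, `a ↦ ∑ₛ a_s v_s`, attached to a bounded family `v` of
vectors of a Banach space `X`; it is the unique bounded linear map with `δ_s ↦ v_s`. -/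
def l1Lift {S X : Type*} [NormedAddCommGroup X] [NormedSpace ℂ X] [CompleteSpace X]
    (v : S → X) (C : ℝ) (hv : ∀ s, ‖v s‖ ≤ C) : ℓ¹(S, ℂ) →L[ℂ] X :=
  LinearMap.mkContinuous
    { toFun := fun a => ∑' s, a s • v s
      map_add' := fun a b => by
        rw [← Summable.tsum_add (l1_summable_smul v C hv a) (l1_summable_smul v C hv b)]
        simp [add_smul]
      map_smul' := fun c a => by
        simp only [lp.coeFn_smul, Pi.smul_apply, smul_assoc, RingHom.id_apply]
        exact (l1_summable_smul v C hv a).tsum_const_smul c }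
    C (fun a => by
      rw [l1_norm_eq, ← tsum_mul_left]
      refine tsum_of_norm_bounded ((l1_summable_norm a).mul_left C).hasSum fun s => ?_
      rw [norm_smul, mul_comm]
      exact mul_le_mul_of_nonneg_right (hv s) (norm_nonneg _))

theorem l1Lift_apply {S X : Type*} [NormedAddCommGroup X] [NormedSpace ℂ X] [CompleteSpace X]
    (v : S → X) (C : ℝ) (hv : ∀ s, ‖v s‖ ≤ C) (a : ℓ¹(S, ℂ)) :
    l1Lift v C hv a = ∑' s, a s • v s := rfl

theorem l1Lift_delta {S X : Type*} [DecidableEq S] [NormedAddCommGroup X] [NormedSpace ℂ X]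
    [CompleteSpace X] (v : S → X) (C : ℝ) (hv : ∀ s, ‖v s‖ ≤ C) (s : S) :
    l1Lift v C hv (delta s) = v s := by
  rw [l1Lift_apply, tsum_eq_single s]
  · simp [delta]
  · intro t ht
    simp [delta, Pi.single_eq_of_ne ht]

theorem norm_delta {S : Type*} [DecidableEq S] (s : S) : ‖delta s‖ = 1 := by
  simp [delta]

theorem norm_l1Lift_le {S X : Type*} [NormedAddCommGroup X] [NormedSpace ℂ X] [CompleteSpace X]
    (v : S → X) (C : ℝ) (hC : 0 ≤ C) (hv : ∀ s, ‖v s‖ ≤ C) : ‖l1Lift v C hv‖ ≤ C :=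
  LinearMap.mkContinuous_norm_le _ hC _

theorem l1_ext {S X : Type*} [DecidableEq S] [NormedAddCommGroup X] [NormedSpace ℂ X]
    {f g : ℓ¹(S, ℂ) →L[ℂ] X} (h : ∀ s, f (delta s) = g (delta s)) : f = g := by
  ext a
  have ha := lp.hasSum_single (by simp) a
  have hs : ∀ s, lp.single 1 s (a s) = (a s) • delta s := fun s => by
    rw [delta, ← lp.single_smul]; simp
  simp only [hs] at ha
  refine (ha.mapL f).unique ?_
  simpa [h] using ha.mapL g

theorem norm_apply_delta_le {S : Type*} [DecidableEq S] (f : StrongDual ℂ ℓ¹(S, ℂ)) (s : S) :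
    ‖f (delta s)‖ ≤ ‖f‖ := by
  simpa [norm_delta] using f.le_opNorm (delta s)

/-! ### Product and coproduct -/

/-- The convolution product of `ℓ¹(S)`, for an additively written semigroup `S`, as a bounded
bilinear map: `δ_s * δ_t = δ_{s+t}`. -/
def conv {S : Type*} [AddSemigroup S] [DecidableEq S] : ℓ¹(S, ℂ) →L[ℂ] ℓ¹(S, ℂ) →L[ℂ] ℓ¹(S, ℂ) :=
  l1Lift (fun s => l1Lift (fun t => delta (s + t)) 1 (fun _ => (norm_delta _).le)) 1
    (fun _ => norm_l1Lift_le _ _ zero_le_one _)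

theorem conv_delta {S : Type*} [AddSemigroup S] [DecidableEq S] (s t : S) :
    conv (delta s) (delta t) = delta (s + t) := by
  rw [conv, l1Lift_delta, l1Lift_delta]

/-- The coproduct `Γ : ℓ¹(S) → ℓ¹(S × S)`, `Γ(δ_s) = δ_{(s,s)}`. -/
def coproduct {S : Type*} [DecidableEq S] : ℓ¹(S, ℂ) →L[ℂ] ℓ¹(S × S, ℂ) :=
  l1Lift (fun s => delta (s, s)) 1 (fun _ => (norm_delta _).le)

/-- For `f, g ∈ ℓ¹(S)* = ℓ^∞(S)`, the functional `f ⊗ g ∈ ℓ¹(S × S)* = ℓ^∞(S × S)`, given by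
`(s, t) ↦ f(s) g(t)`. -/
def tensor {S : Type*} [DecidableEq S] (f g : StrongDual ℂ ℓ¹(S, ℂ)) :
    StrongDual ℂ ℓ¹(S × S, ℂ) :=
  l1Lift (fun p => f (delta p.1) * g (delta p.2)) (‖f‖ * ‖g‖) (fun p => by
    rw [norm_mul]
    exact mul_le_mul (norm_apply_delta_le f _) (norm_apply_delta_le g _) (norm_nonneg _)
      (norm_nonneg _))

/-- The product of `ℓ¹(S)* = ℓ^∞(S)`: pointwise multiplication of functions on `S`. -/
def pointwiseMul {S : Type*} [DecidableEq S] (f g : StrongDual ℂ ℓ¹(S, ℂ)) :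
    StrongDual ℂ ℓ¹(S, ℂ) :=
  l1Lift (fun s => f (delta s) * g (delta s)) (‖f‖ * ‖g‖) (fun s => by
    rw [norm_mul]
    exact mul_le_mul (norm_apply_delta_le f _) (norm_apply_delta_le g _) (norm_nonneg _)
      (norm_nonneg _))

/-! ### Preduals -/

/-- The canonical map `A → E*`, `a ↦ (f ↦ ⟨f, a⟩)`, for a subspace `E` of `A*`. -/
def toDual {A : Type*} [NormedAddCommGroup A] [NormedSpace ℂ A]
    (E : Submodule ℂ (StrongDual ℂ A)) (a : A) : StrongDual ℂ E :=
  (NormedSpace.inclusionInDoubleDual ℂ A a).comp E.subtypeL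

/-- The topology `σ(A, E)`: the weakest topology on `A` making all functionals in `E` continuous.
If `E` is a predual of `A`, this is the associated weak* topology. -/
def weakStar {A : Type*} [NormedAddCommGroup A] [NormedSpace ℂ A]
    (E : Submodule ℂ (StrongDual ℂ A)) : TopologicalSpace A :=
  ⨅ f : E, TopologicalSpace.induced (fun a => (f : StrongDual ℂ A) a) inferInstance

/-- A predual of the Banach algebra `ℓ¹(S)`: a closed `ℓ¹(S)`-submodule `E` of `ℓ¹(S)*` (for the
actions `⟨f · a, b⟩ = ⟨f, a * b⟩` and `⟨a · f, b⟩ = ⟨f, b * a⟩`) which is a Banach space predual of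
`ℓ¹(S)`, in that the canonical bounded map `ℓ¹(S) → E*` is a bijection, hence an isomorphism of
Banach spaces. -/
structure IsPredual {S : Type*} [AddSemigroup S] [DecidableEq S]
    (E : Submodule ℂ (StrongDual ℂ ℓ¹(S, ℂ))) : Prop where
  isClosed : IsClosed (E : Set (StrongDual ℂ ℓ¹(S, ℂ)))
  act_right : ∀ f ∈ E, ∀ a : ℓ¹(S, ℂ), f.comp (conv a) ∈ E
  act_left : ∀ f ∈ E, ∀ a : ℓ¹(S, ℂ), f.comp (conv.flip a) ∈ E
  bijective : Function.Bijective (toDual E)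

/-- The closed linear span of `{f ⊗ g : f, g ∈ E}` in `ℓ¹(S × S)*`, the predual of `ℓ¹(S × S)`
induced by a predual `E` of `ℓ¹(S)`. -/
def tensorPredual {S : Type*} [DecidableEq S] (E : Submodule ℂ (StrongDual ℂ ℓ¹(S, ℂ))) :
    Submodule ℂ (StrongDual ℂ ℓ¹(S × S, ℂ)) :=
  (Submodule.span ℂ {h | ∃ f ∈ E, ∃ g ∈ E, h = tensor f g}).topologicalClosure

/-- A Hopf algebra predual of `ℓ¹(S)`: a predual for which the coproduct is weak*-continuous. -/
structure IsHopfPredual {S : Type*} [AddSemigroup S] [DecidableEq S]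
    (E : Submodule ℂ (StrongDual ℂ ℓ¹(S, ℂ))) : Prop extends IsPredual E where
  coproduct_continuous : Continuous[weakStar E, weakStar (tensorPredual E)] (coproduct (S := S))

theorem tensor_comp_coproduct {S : Type*} [DecidableEq S] (f g : StrongDual ℂ ℓ¹(S, ℂ)) :
    (tensor f g).comp coproduct = pointwiseMul f g := by
  refine l1_ext fun s => ?_
  simp [coproduct, tensor, pointwiseMul, l1Lift_delta]

theorem mem_iff_continuous_weakStar {A : Type*} [NormedAddCommGroup A] [NormedSpace ℂ A]
    (E : Submodule ℂ (StrongDual ℂ A)) (φ : StrongDual ℂ A) :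
    φ ∈ E ↔ Continuous[weakStar E, inferInstance] φ := by
  have h := LinearMap.mem_span_iff_continuous (𝕜 := ℂ)
    (f := fun f : E => ((f : StrongDual ℂ A) : A →ₗ[ℂ] ℂ)) (φ : A →ₗ[ℂ] ℂ)
  refine Iff.trans ?_ h
  have hr : Set.range (fun f : E => ((f : StrongDual ℂ A) : A →ₗ[ℂ] ℂ)) =
      (E.map (ContinuousLinearMap.coeLM ℂ : (A →L[ℂ] ℂ) →ₗ[ℂ] (A →ₗ[ℂ] ℂ)) :
        Set (A →ₗ[ℂ] ℂ)) := by
    ext x; simp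
  rw [hr, Submodule.span_eq, Submodule.mem_map]
  constructor
  · intro hφ
    exact ⟨φ, hφ, rfl⟩
  · rintro ⟨ψ, hψ, e⟩
    have : ψ = φ := ContinuousLinearMap.coe_injective e
    exact this ▸ hψ

/-- The coproduct is weak*-continuous for a predual `E` if and only if `E` is a subalgebra of
`ℓ^∞(S)`. -/
theorem isHopfPredual_iff {S : Type*} [AddSemigroup S] [DecidableEq S]
    (E : Submodule ℂ (StrongDual ℂ ℓ¹(S, ℂ))) :
    IsHopfPredual E ↔ IsPredual E ∧ ∀ f ∈ E, ∀ g ∈ E, pointwiseMul f g ∈ E := by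
  have key : ∀ h : StrongDual ℂ ℓ¹(S × S, ℂ), h ∈ tensorPredual E →
      Continuous[weakStar (tensorPredual E), inferInstance] h :=
    fun h hh => (mem_iff_continuous_weakStar _ h).1 hh
  constructor
  · intro H
    refine ⟨H.toIsPredual, fun f hf g hg => ?_⟩
    rw [← tensor_comp_coproduct, mem_iff_continuous_weakStar]
    have h1 := key (tensor f g) (Submodule.le_topologicalClosure _
      (Submodule.subset_span ⟨f, hf, g, hg, rfl⟩))
    exact @Continuous.comp _ _ _ (weakStar E) (weakStar (tensorPredual E)) _ _ _ h1
      H.coproduct_continuous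
  · rintro ⟨H, hm⟩
    refine { toIsPredual := H, coproduct_continuous := ?_ }
    have hsub : tensorPredual E ≤
        E.comap ((ContinuousLinearMap.compL ℂ ℓ¹(S, ℂ) ℓ¹(S × S, ℂ) ℂ).flip coproduct :
          StrongDual ℂ ℓ¹(S × S, ℂ) →ₗ[ℂ] StrongDual ℂ ℓ¹(S, ℂ)) := by
      refine Submodule.topologicalClosure_minimal _ (Submodule.span_le.2 ?_) ?_
      · rintro _ ⟨f, hf, g, hg, rfl⟩
        change (tensor f g).comp coproduct ∈ E
        rw [tensor_comp_coproduct]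
        exact hm f hf g hg
      · exact H.isClosed.preimage
          ((ContinuousLinearMap.compL ℂ ℓ¹(S, ℂ) ℓ¹(S × S, ℂ) ℂ).flip coproduct).continuous
    refine continuous_iInf_rng.2 fun h => continuous_induced_rng.2 ?_
    exact (mem_iff_continuous_weakStar E ((h : StrongDual ℂ ℓ¹(S × S, ℂ)).comp coproduct)).1
      (hsub h.2)

/-- `C₀(S, σ)` as a subspace of `ℓ¹(S)* = ℓ^∞(S)`: the functionals `f` for which the function
`s ↦ ⟨f, δ_s⟩` on `S` is `σ`-continuous and vanishes at infinity. -/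
def C0 {S : Type*} [DecidableEq S] (σ : TopologicalSpace S) :
    Submodule ℂ (StrongDual ℂ ℓ¹(S, ℂ)) where
  carrier := {f | Continuous[σ, inferInstance] (fun s => f (delta s)) ∧
    Tendsto (fun s => f (delta s)) (@cocompact S σ) (𝓝 0)}
  zero_mem' := ⟨by simpa using @continuous_const _ _ σ _ (0 : ℂ), by
    simpa using tendsto_const_nhds⟩
  add_mem' := fun hf hg => ⟨@Continuous.add _ _ _ _ _ σ _ _ hf.1 hg.1,
    by simpa using hf.2.add hg.2⟩
  smul_mem' := fun c _ hf => ⟨@Continuous.const_smul _ _ _ _ _ _ σ _ hf.1 c,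
    by simpa using hf.2.const_smul c⟩

/-- A semigroup (written additively) with a topology is semitopological if its operation is
separately continuous. -/
def IsSemitopological {S : Type*} [AddSemigroup S] (σ : TopologicalSpace S) : Prop :=
  ∀ t : S, Continuous[σ, σ] (fun x => t + x) ∧ Continuous[σ, σ] (fun x => x + t)

/-! ### The topologies on `ℤ₊ × ℤ` -/

/-- The number `w_n = 2^{2^n}`. -/
def w (n : ℕ) : ℤ := 2 ^ 2 ^ n

/-- For a sequence `v` of integers, the set `U_{a,s,α}` of all `(a - k, s + v_{i_1} + ⋯ + v_{i_k})`
with `0 ≤ k ≤ a` and `α ≤ i_1 < ⋯ < i_k`. -/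
def basicNhd (v : ℕ → ℤ) (a : ℕ) (s : ℤ) (α : ℕ) : Set (ℕ × ℤ) :=
  {p | ∃ F : Finset ℕ, (∀ i ∈ F, α ≤ i) ∧ p.1 + F.card = a ∧ p.2 = s + ∑ i ∈ F, v i}

/-- The collection of all the sets `U_{a,s,α}`. -/
def basicNhds (v : ℕ → ℤ) : Set (Set (ℕ × ℤ)) :=
  {U | ∃ a s α, U = basicNhd v a s α}

/-- The topology on `ℤ₊ × ℤ` generated by the sets `U_{a,s,α}`. -/
def sigma (v : ℕ → ℤ) : TopologicalSpace (ℕ × ℤ) :=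
  TopologicalSpace.generateFrom (basicNhds v)

end SemigroupPredual

end

/-! By `isHopfPredual_iff` a Hopf algebra predual is a predual closed under pointwise products,
which is automatic for a space `C0 σ`. The two substantial points are the duality `C₀(S)* = ℓ¹(S)`
and the distinctness of sufficiently many of these spaces.

Duality (`bijective_toDual_C0`) is a Riesz theorem for scattered spaces. The mass at `p` of a
functional `Φ` is a limit of `Φ(1_U)` over shrinking compact open `U ∋ p`. Subtracting these point
masses leaves a functional that vanishes locally, by induction on rank, and hence on all of `C₀`.
For `sigma v` the rank is the first coordinate. Compactness of the basic sets (`isCompact_basicNhd`)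
is an induction on that coordinate, and the Hausdorff property comes from `IsLacunary`. The module
property holds because translations are continuous and proper.

For the count, `C0 (sigma v) ≤ C0 (sigma u)` forces almost all terms of `u` to be terms of `v`
(`eventually_mem_range_of_C0_le`). The branches of the binary tree give continuum many sequences `m`
whose ranges meet pairwise in finite sets, so their preduals are distinct. -/

namespace SemigroupPredual

/-! ### Bounded functions and indicators as functionals on `ℓ¹(S)`. -/

section General

variable {S : Type*} [DecidableEq S]

theorem apply_eq_tsum (f : StrongDual ℂ ℓ¹(S, ℂ)) (a : ℓ¹(S, ℂ)) :
    f a = ∑' s, a s * f (delta s) := by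
  have h : f = l1Lift (fun s => f (delta s)) ‖f‖ (norm_apply_delta_le f) :=
    l1_ext fun s => by rw [l1Lift_delta]
  conv_lhs => rw [h, l1Lift_apply]
  simp

theorem norm_le_of_forall_delta (f : StrongDual ℂ ℓ¹(S, ℂ)) {C : ℝ} (hC : 0 ≤ C)
    (h : ∀ s, ‖f (delta s)‖ ≤ C) : ‖f‖ ≤ C := by
  have e : f = l1Lift (fun s => f (delta s)) C h := l1_ext fun s => by rw [l1Lift_delta]
  rw [e]
  exact norm_l1Lift_le _ _ hC _

theorem pointwiseMul_delta (f g : StrongDual ℂ ℓ¹(S, ℂ)) (s : S) :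
    pointwiseMul f g (delta s) = f (delta s) * g (delta s) := by
  rw [pointwiseMul, l1Lift_delta]

open Classical in
/-- The indicator function of `V`, as an element of `ℓ¹(S)* = ℓ^∞(S)`. -/
noncomputable def indic (V : Set S) : StrongDual ℂ ℓ¹(S, ℂ) :=
  l1Lift (fun s => if s ∈ V then 1 else 0) 1 (fun s => by split_ifs <;> simp)

theorem indic_delta_of_mem {V : Set S} {s : S} (h : s ∈ V) : indic V (delta s) = 1 := by
  rw [indic, l1Lift_delta, if_pos h]

theorem indic_delta_of_notMem {V : Set S} {s : S} (h : s ∉ V) : indic V (delta s) = 0 := by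
  rw [indic, l1Lift_delta, if_neg h]

theorem norm_indic_le {S : Type*} (V : Set S) : ‖indic V‖ ≤ 1 := norm_l1Lift_le _ _ zero_le_one _

theorem pointwiseMul_indic_sdiff {V W : Set S} (h : W ⊆ V) (f : StrongDual ℂ ℓ¹(S, ℂ)) :
    pointwiseMul (indic V) f =
      pointwiseMul (indic (V \ W)) f + pointwiseMul (indic W) f := by
  refine l1_ext fun s => ?_
  rw [_root_.add_apply]
  simp only [pointwiseMul_delta]
  by_cases hW : s ∈ W
  · have : s ∉ V \ W := fun h => h.2 hW
    simp [indic_delta_of_mem hW, indic_delta_of_mem (h hW), indic_delta_of_notMem this]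
  · by_cases hV : s ∈ V
    · have : s ∈ V \ W := ⟨hV, hW⟩
      simp [indic_delta_of_mem hV, indic_delta_of_mem this, indic_delta_of_notMem hW]
    · have : s ∉ V \ W := fun h => hV h.1
      simp [indic_delta_of_notMem hV, indic_delta_of_notMem this, indic_delta_of_notMem hW]

/-- Test `Φ` on `∑ c_p 1_{V_p}`, with `c_p` rotating each value onto the positive axis; disjointness
keeps the sup norm at most `1`. -/
theorem sum_norm_indic_le (Φ : StrongDual ℂ (StrongDual ℂ ℓ¹(S, ℂ))) {ι : Type*} (T : Finset ι)
    {V : ι → Set S} (hV : (T : Set ι).PairwiseDisjoint V) :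
    ∑ p ∈ T, ‖Φ (indic (V p))‖ ≤ ‖Φ‖ := by
  have hc : ∀ z : ℂ, ∃ c : ℂ, ‖c‖ ≤ 1 ∧ c * z = ‖z‖ := fun z => by
    by_cases hz : z = 0
    · exact ⟨0, by simp, by simp [hz]⟩
    · have : (‖z‖ : ℂ) ≠ 0 := by simpa using hz
      exact ⟨‖z‖ / z, by simp [hz], by field_simp⟩
  choose c hc1 hc2 using fun p => hc (Φ (indic (V p)))
  have h1 : ‖∑ p ∈ T, c p • indic (V p)‖ ≤ 1 := by
    refine norm_le_of_forall_delta _ zero_le_one fun s => ?_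
    rw [_root_.sum_apply]
    by_cases hs : ∃ p ∈ T, s ∈ V p
    · obtain ⟨p, hp, hsp⟩ := hs
      rw [Finset.sum_eq_single_of_mem p hp]
      · simpa [indic_delta_of_mem hsp] using hc1 p
      · intro q hq hqp
        have : s ∉ V q := fun h => disjoint_left.1 (hV hq hp hqp) h hsp
        simp [indic_delta_of_notMem this]
    · rw [Finset.sum_eq_zero]
      · simp
      · intro q hq
        have : s ∉ V q := fun h => hs ⟨q, hq, h⟩
        simp [indic_delta_of_notMem this]
  have h2 : Φ (∑ p ∈ T, c p • indic (V p)) = ((∑ p ∈ T, ‖Φ (indic (V p))‖ : ℝ) : ℂ) := by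
    rw [map_sum, Complex.ofReal_sum]
    refine Finset.sum_congr rfl fun p _ => ?_
    rw [map_smul, smul_eq_mul, hc2]
  have h3 := Φ.le_opNorm (∑ p ∈ T, c p • indic (V p))
  rw [h2, Complex.norm_real, Real.norm_of_nonneg (by positivity)] at h3
  exact h3.trans (mul_le_of_le_one_right (norm_nonneg _) h1)

/-! ### `C₀(S)` and its dual. -/

section Topological

variable [σ : TopologicalSpace S]

theorem mem_C0_iff {f : StrongDual ℂ ℓ¹(S, ℂ)} :
    f ∈ C0 σ ↔ Continuous (fun s => f (delta s)) ∧
      Tendsto (fun s => f (delta s)) (cocompact S) (𝓝 0) := Iff.rfl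

theorem continuous_indic {V : Set S} (hV : IsClopen V) :
    Continuous fun s => indic V (delta s) := by
  classical
  have : (fun s => indic V (delta s)) = fun s => if s ∈ V then (1 : ℂ) else 0 := by
    funext s; rw [indic, l1Lift_delta]
  rw [this]
  refine continuous_if (fun a ha => ?_) continuousOn_const continuousOn_const
  rw [Set.ofPred_mem_eq, hV.frontier_eq] at ha
  exact ha.elim

theorem indic_mem_C0 {V : Set S} (hV : IsClopen V) (hc : IsCompact V) : indic V ∈ C0 σ := by
  refine ⟨continuous_indic hV, tendsto_const_nhds.congr' ?_⟩
  filter_upwards [hc.compl_mem_cocompact] with s hs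
  exact (indic_delta_of_notMem hs).symm

theorem pointwiseMul_mem_C0 {f g : StrongDual ℂ ℓ¹(S, ℂ)}
    (hf : Continuous fun s => f (delta s)) (hg : g ∈ C0 σ) : pointwiseMul f g ∈ C0 σ := by
  refine mem_C0_iff.2 ⟨?_, ?_⟩
  · simp only [pointwiseMul_delta]
    exact hf.mul hg.1
  · simp only [pointwiseMul_delta]
    refine squeeze_zero_norm (a := fun s => ‖f‖ * ‖g (delta s)‖) (fun s => ?_) ?_
    · rw [norm_mul]
      exact mul_le_mul_of_nonneg_right (norm_apply_delta_le f s) (norm_nonneg _)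
    · simpa using hg.2.norm.const_mul ‖f‖

theorem isClosed_C0 : IsClosed (C0 σ : Set (StrongDual ℂ ℓ¹(S, ℂ))) := by
  refine isClosed_of_closure_subset fun f hf => ?_
  have key : ∀ ε > 0, ∃ g ∈ C0 σ, ∀ s, ‖f (delta s) - g (delta s)‖ < ε := fun ε hε => by
    obtain ⟨g, hg, hd⟩ := Metric.mem_closure_iff.1 hf ε hε
    refine ⟨g, hg, fun s => ?_⟩
    rw [dist_eq_norm] at hd
    exact (norm_apply_delta_le (f - g) s).trans_lt hd
  refine mem_C0_iff.2 ⟨?_, ?_⟩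
  · refine continuous_of_uniform_approx_of_continuous fun u hu => ?_
    obtain ⟨ε, hε, h⟩ := Metric.mem_uniformity_dist.1 hu
    obtain ⟨g, hg, hd⟩ := key ε hε
    exact ⟨fun s => g (delta s), hg.1, fun s => h (by rw [dist_eq_norm]; exact hd s)⟩
  · refine Metric.tendsto_nhds.2 fun ε hε => ?_
    obtain ⟨g, hg, hd⟩ := key (ε / 2) (by positivity)
    filter_upwards [Metric.tendsto_nhds.1 hg.2 (ε / 2) (by positivity)] with s hs
    rw [dist_zero_right] at hs ⊢
    calc ‖f (delta s)‖ = ‖(f (delta s) - g (delta s)) + g (delta s)‖ := by simp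
      _ ≤ _ := norm_add_le _ _
      _ < ε := by linarith [hd s]

/-- A functional `Φ` on `ℓ^∞(S)` is null on `V` if it kills `f · 1_V` for all `f ∈ C₀(S)`. -/
def NullOn (Φ : StrongDual ℂ (StrongDual ℂ ℓ¹(S, ℂ))) (V : Set S) : Prop :=
  ∀ f ∈ C0 σ, Φ (pointwiseMul (indic V) f) = 0

variable {Φ : StrongDual ℂ (StrongDual ℂ ℓ¹(S, ℂ))}

theorem NullOn.mono {V W : Set S} (hW : NullOn Φ W) (hV : IsClopen V) (h : V ⊆ W) :
    NullOn Φ V := fun f hf => by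
  rw [← hW _ (pointwiseMul_mem_C0 (continuous_indic hV) hf)]
  congr 1
  refine l1_ext fun s => ?_
  simp only [pointwiseMul_delta]
  by_cases hs : s ∈ V
  · simp [indic_delta_of_mem hs, indic_delta_of_mem (h hs)]
  · simp [indic_delta_of_notMem hs]

/-- Split the union as `(V ∪ W) \ W` and `W`; the first piece is a clopen subset of `V`. -/
theorem NullOn.union {V W : Set S} (hV : NullOn Φ V) (hW : NullOn Φ W) (cV : IsClopen V)
    (cW : IsClopen W) : NullOn Φ (V ∪ W) := fun f hf => by
  rw [pointwiseMul_indic_sdiff subset_union_right, map_add, hW f hf, add_zero]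
  exact hV.mono ((cV.union cW).diff cW) (by simp) f hf

theorem exists_nullOn_superset {K : Set S} (hK : IsCompact K)
    (h : ∀ x ∈ K, ∃ V ∈ 𝓝 x, IsClopen V ∧ NullOn Φ V) :
    ∃ W, K ⊆ W ∧ IsClopen W ∧ NullOn Φ W := by
  refine hK.induction_on (p := fun s => ∃ W, s ⊆ W ∧ IsClopen W ∧ NullOn Φ W) ?_ ?_ ?_ ?_
  · refine ⟨∅, subset_rfl, isClopen_empty, fun f _ => ?_⟩
    have : pointwiseMul (indic ∅) f = 0 := l1_ext fun s => by
      rw [pointwiseMul_delta, indic_delta_of_notMem (notMem_empty s)]; simp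
    rw [this, map_zero]
  · rintro s t hst ⟨W, h1, h2⟩
    exact ⟨W, hst.trans h1, h2⟩
  · rintro s t ⟨W, h1, h2, h3⟩ ⟨W', h1', h2', h3'⟩
    exact ⟨W ∪ W', union_subset_union h1 h1', h2.union h2', h3.union h3' h2 h2'⟩
  · intro x hx
    obtain ⟨V, hV, h2⟩ := h x hx
    exact ⟨V, mem_nhdsWithin_of_mem_nhds hV, V, subset_rfl, h2⟩

/-- Outside a compact set `f` is smaller than `ε`, and that compact set lies in a null clopen `W`,
so `Φ f = Φ (f - 1_W f)` has norm at most `‖Φ‖ ε`. -/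
theorem eq_zero_of_locally_nullOn (h : ∀ x : S, ∃ V ∈ 𝓝 x, IsClopen V ∧ NullOn Φ V)
    {f : StrongDual ℂ ℓ¹(S, ℂ)} (hf : f ∈ C0 σ) : Φ f = 0 := by
  have key : ∀ ε > 0, ‖Φ f‖ ≤ ‖Φ‖ * ε := fun ε hε => by
    have hcoc := Metric.tendsto_nhds.1 hf.2 ε hε
    obtain ⟨K, hK, hKs⟩ := mem_cocompact.1 hcoc
    obtain ⟨W, hKW, -, hW⟩ := exists_nullOn_superset (Φ := Φ) hK fun x _ => h x
    have e : Φ f = Φ (f - pointwiseMul (indic W) f) := by rw [map_sub, hW f hf, sub_zero]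
    rw [e]
    refine (Φ.le_opNorm _).trans (mul_le_mul_of_nonneg_left ?_ (norm_nonneg _))
    refine norm_le_of_forall_delta _ hε.le fun s => ?_
    rw [_root_.sub_apply, pointwiseMul_delta]
    by_cases hs : s ∈ W
    · simp [indic_delta_of_mem hs, hε.le]
    · have := hKs fun hK => hs (hKW hK)
      rw [mem_ofPred_eq, dist_zero_right] at this
      simpa [indic_delta_of_notMem hs] using this.le
  have ht : Tendsto (fun ε : ℝ => ‖Φ‖ * ε) (𝓝[>] 0) (𝓝 0) := by
    have : Tendsto (fun ε : ℝ => ‖Φ‖ * ε) (𝓝 0) (𝓝 (‖Φ‖ * 0)) := tendsto_id.const_mul _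
    rw [mul_zero] at this
    exact this.mono_left nhdsWithin_le_nhds
  refine norm_le_zero_iff.1 (ge_of_tendsto ht ?_)
  filter_upwards [self_mem_nhdsWithin] with ε hε using key ε hε

theorem tendsto_pointwiseMul_indic {p : S} {U : ℕ → Set S} (hU : (𝓝 p).HasAntitoneBasis U)
    {f : StrongDual ℂ ℓ¹(S, ℂ)} (hf : Continuous fun s => f (delta s)) :
    Tendsto (fun n => pointwiseMul (indic (U n)) f - f (delta p) • indic (U n)) atTop (𝓝 0) := by
  refine Metric.tendsto_nhds.2 fun ε hε => ?_
  have h1 := Metric.tendsto_nhds.1 (hf.tendsto p) (ε / 2) (by positivity)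
  obtain ⟨n, -, hn⟩ := hU.toHasBasis.mem_iff.1 h1
  filter_upwards [eventually_ge_atTop n] with k hk
  rw [dist_zero_right]
  refine (norm_le_of_forall_delta _ (by positivity : 0 ≤ ε / 2) fun s => ?_).trans_lt
    (half_lt_self hε)
  rw [_root_.sub_apply, pointwiseMul_delta, _root_.smul_apply]
  by_cases hs : s ∈ U k
  · have := hn (hU.antitone hk hs)
    rw [mem_ofPred_eq, dist_eq_norm] at this
    simpa [indic_delta_of_mem hs] using this.le
  · simp [indic_delta_of_notMem hs]
    positivity

/-- Dominated convergence, as `1_{U n} → 1_{p}` pointwise. This recovers the coefficients of `a`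
from its pairings with indicators. -/
theorem tendsto_indic_apply [T1Space S] {p : S} {U : ℕ → Set S}
    (hU : (𝓝 p).HasAntitoneBasis U) (a : ℓ¹(S, ℂ)) :
    Tendsto (fun n => indic (U n) a) atTop (𝓝 (a p)) := by
  have e : a p = ∑' s, a s * indic {p} (delta s) := by
    rw [tsum_eq_single p, indic_delta_of_mem (mem_singleton p), mul_one]
    intro s hs
    rw [indic_delta_of_notMem (show s ∉ ({p} : Set S) from hs), mul_zero]
  rw [e]
  simp only [fun n => apply_eq_tsum (indic (U n)) a]
  refine tendsto_tsum_of_dominated_convergence (bound := fun s => ‖a s‖) (l1_summable_norm a)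
    (fun s => ?_) (Eventually.of_forall fun n s => ?_)
  · refine tendsto_const_nhds.mul (tendsto_const_nhds.congr' ?_)
    by_cases hs : s = p
    · subst s
      refine Eventually.of_forall fun n => ?_
      change indic {p} (delta p) = indic (U n) (delta p)
      rw [indic_delta_of_mem (mem_singleton p),
        indic_delta_of_mem (mem_of_mem_nhds (hU.toHasBasis.mem_of_mem trivial))]
    · obtain ⟨n, -, hn⟩ := hU.toHasBasis.mem_iff.1 (isOpen_ne.mem_nhds (Ne.symm hs))
      filter_upwards [eventually_ge_atTop n] with k hk
      rw [indic_delta_of_notMem (show s ∉ ({p} : Set S) from hs),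
        indic_delta_of_notMem fun h => hn (hU.antitone hk h) rfl]
  · rw [norm_mul]
    refine mul_le_of_le_one_right (norm_nonneg _) ?_
    exact (norm_apply_delta_le _ s).trans (norm_indic_le _)

/-- A Riesz representation theorem for scattered spaces of finite rank: if every point `p` has a
countable base of compact open neighbourhoods, all of whose points other than `p` have smaller rank
than `p`, then `C₀(S)* = ℓ¹(S)`. -/
theorem bijective_toDual_C0 [T2Space S] {U : S → ℕ → Set S}
    (hU : ∀ p, (𝓝 p).HasAntitoneBasis (U p)) (ho : ∀ p n, IsOpen (U p n))
    (hc : ∀ p n, IsCompact (U p n)) {r : S → ℕ}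
    (hr : ∀ p n, ∀ q ∈ U p n, q ≠ p → r q < r p) : Function.Bijective (toDual (C0 σ)) := by
  have clo : ∀ p n, IsClopen (U p n) := fun p n => ⟨(hc p n).isClosed, ho p n⟩
  have memU : ∀ p n, U p n ∈ 𝓝 p := fun p n => (hU p).toHasBasis.mem_of_mem trivial
  have hmem : ∀ p n, indic (U p n) ∈ C0 σ := fun p n => indic_mem_C0 (clo p n) (hc p n)
  constructor
  · intro a b hab
    ext p
    refine tendsto_nhds_unique (tendsto_indic_apply (hU p) a)
      ((tendsto_indic_apply (hU p) b).congr fun n => ?_)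
    exact (DFunLike.congr_fun hab ⟨_, hmem p n⟩).symm
  · intro φ
    -- Hahn–Banach extension, so that the functional can be evaluated without carrying membership in
    -- `C₀`.
    obtain ⟨Φ, hΦ, -⟩ := exists_extension_norm_eq (C0 σ) φ
    have hlim : ∀ p, ∃ z, Tendsto (fun n => Φ (indic (U p n))) (hyperfilter ℕ) (𝓝 z) := fun p => by
      have hb : ∀ n, Φ (indic (U p n)) ∈ Metric.closedBall (0 : ℂ) ‖Φ‖ := fun n => by
        rw [mem_closedBall_zero_iff]
        exact (Φ.le_opNorm _).trans (mul_le_of_le_one_right (norm_nonneg _) (norm_indic_le _))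
      obtain ⟨z, -, hz⟩ := (isCompact_closedBall (0 : ℂ) ‖Φ‖).ultrafilter_le_nhds
        ((hyperfilter ℕ).map fun n => Φ (indic (U p n)))
        (le_principal_iff.2 (Ultrafilter.mem_map.2 (univ_mem' hb)))
      exact ⟨z, hz⟩
    choose a ha using hlim
    have hsum : ∀ T : Finset S, ∑ p ∈ T, ‖a p‖ ≤ ‖Φ‖ := fun T => by
      refine le_of_tendsto (tendsto_finsetSum T fun p _ => (ha p).norm)
        (Nat.hyperfilter_le_atTop ?_)
      -- Finitely many distinct points eventually have disjoint basic neighbourhoods, so the bound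
      -- for disjoint indicators passes to the limit.
      have : ∀ᶠ n in atTop, ∀ p ∈ T, ∀ q ∈ T, p ≠ q → Disjoint (U p n) (U q n) := by
        refine (Finset.eventually_all T).2 fun p _ => (Finset.eventually_all T).2 fun q _ => ?_
        by_cases hpq : p = q
        · exact Eventually.of_forall fun n h => (h hpq).elim
        · obtain ⟨A, B, hA, hB, hAB⟩ := t2_separation_nhds hpq
          obtain ⟨i, -, hi⟩ := (hU p).toHasBasis.mem_iff.1 hA
          obtain ⟨j, -, hj⟩ := (hU q).toHasBasis.mem_iff.1 hB
          filter_upwards [eventually_ge_atTop i, eventually_ge_atTop j] with n h1 h2 _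
          exact hAB.mono (((hU p).antitone h1).trans hi) (((hU q).antitone h2).trans hj)
      filter_upwards [this] with n hn
      exact sum_norm_indic_le Φ T fun p hp q hq hpq => hn p hp q hq hpq
    have hmemℓ : Memℓp a 1 := memℓp_gen (by simpa using summable_of_sum_le (fun _ => norm_nonneg _) hsum)
    let x : ℓ¹(S, ℂ) := ⟨a, hmemℓ⟩
    refine ⟨x, ?_⟩
    set Ψ : StrongDual ℂ (StrongDual ℂ ℓ¹(S, ℂ)) :=
      Φ - NormedSpace.inclusionInDoubleDual ℂ _ x with hΨ
    have hΨ0 : ∀ p, Tendsto (fun n => Ψ (indic (U p n))) (hyperfilter ℕ) (𝓝 0) := fun p => by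
      have := (ha p).sub ((tendsto_indic_apply (hU p) x).mono_left Nat.hyperfilter_le_atTop)
      rw [show x p = a p from rfl, sub_self] at this
      exact this
    have hnull : ∀ k p, r p = k → ∀ n, NullOn Ψ (U p n) := by
      intro k
      induction k using Nat.strong_induction_on with
      | _ k ih =>
        rintro p rfl n f hf
        -- `U p n \ U p j` is compact and all its points have smaller rank, so it is covered by a
        -- null clopen set.
        have hconst : ∀ j, n ≤ j →
            Ψ (pointwiseMul (indic (U p j)) f) = Ψ (pointwiseMul (indic (U p n)) f) := by
          intro j hj
          rw [pointwiseMul_indic_sdiff ((hU p).antitone hj), map_add]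
          obtain ⟨W, hW, -, hWn⟩ := exists_nullOn_superset (Φ := Ψ)
            ((hc p n).diff (ho p j)) fun q hq => ⟨U q 0, memU q 0, clo q 0,
              ih (r q) (hr p n q hq.1 fun h => hq.2 (h.symm ▸ mem_of_mem_nhds (memU p j))) q rfl 0⟩
          rw [hWn.mono ((clo p n).diff (clo p j)) hW f hf, zero_add]
        -- In norm `1_{U j} f` approaches `f(p) 1_{U j}`, and `Ψ (1_{U j})` tends to `0`.
        have h1 : Tendsto (fun j => Ψ (pointwiseMul (indic (U p j)) f)) (hyperfilter ℕ)
            (𝓝 0) := by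
          have h2 := (Ψ.continuous.tendsto 0).comp
            ((tendsto_pointwiseMul_indic (hU p) hf.1).mono_left Nat.hyperfilter_le_atTop)
          have h3 := h2.add ((hΨ0 p).const_mul (f (delta p)))
          simpa [Function.comp_def] using h3
        refine tendsto_nhds_unique (tendsto_const_nhds.congr' ?_) h1
        filter_upwards [Nat.hyperfilter_le_atTop (eventually_ge_atTop n)] with j hj
        exact (hconst j hj).symm
    ext f
    have h0 := eq_zero_of_locally_nullOn (Φ := Ψ)
      (fun p => ⟨U p 0, memU p 0, clo p 0, hnull _ p rfl 0⟩) f.2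
    rw [hΨ, _root_.sub_apply, hΦ, sub_eq_zero] at h0
    exact h0.symm

end Topological

/-! ### The module property. -/

theorem apply_mem_of_forall_delta {X : Type*} [NormedAddCommGroup X] [NormedSpace ℂ X]
    {E : Submodule ℂ X} (hE : IsClosed (E : Set X)) (L : ℓ¹(S, ℂ) →L[ℂ] X)
    (h : ∀ s, L (delta s) ∈ E) (a : ℓ¹(S, ℂ)) : L a ∈ E := by
  have ha := (lp.hasSum_single (by simp) a).mapL L
  refine hE.mem_of_tendsto ha (Eventually.of_forall fun T => E.sum_mem fun s _ => ?_)
  have hs : lp.single 1 s (a s) = (a s) • delta s := by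
    rw [delta, ← lp.single_smul]; simp
  rw [hs, map_smul]
  exact E.smul_mem _ (h s)

/-- As `C₀` is closed, it suffices to take `a = δ_t`, which acts on functions by translation. -/
theorem comp_conv_mem_C0 [AddSemigroup S] {σ : TopologicalSpace S}
    (hcont : ∀ t : S, Continuous fun x => t + x)
    (hprop : ∀ t : S, Tendsto (fun x => t + x) (cocompact S) (cocompact S))
    {f : StrongDual ℂ ℓ¹(S, ℂ)} (hf : f ∈ C0 σ) (a : ℓ¹(S, ℂ)) : f.comp (conv a) ∈ C0 σ := by
  refine apply_mem_of_forall_delta isClosed_C0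
    ((ContinuousLinearMap.compL ℂ ℓ¹(S, ℂ) ℓ¹(S, ℂ) ℂ f).comp conv) (fun t => ?_) a
  refine mem_C0_iff.2 ⟨?_, ?_⟩
  · simpa [conv_delta, Function.comp_def] using hf.1.comp (hcont t)
  · simpa [conv_delta, Function.comp_def] using hf.2.comp (hprop t)

theorem conv_flip {M : Type*} [AddCommSemigroup M] [DecidableEq M] :
    (conv (S := M)).flip = conv :=
  l1_ext fun s => l1_ext fun t => by
    rw [ContinuousLinearMap.flip_apply, conv_delta, conv_delta, add_comm]

end General

/-! ### The topologies `sigma v`. -/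

section Sigma

variable {v : ℕ → ℤ}

/-- The properties of the sequence `w ∘ m` that the topology `sigma (w ∘ m)` depends on: each term
divides the later ones, the terms tend to infinity, and finite sums of distinct terms determine
the terms. -/
structure IsLacunary (v : ℕ → ℤ) : Prop where
  dvd : ∀ i j, i ≤ j → v i ∣ v j
  lt : ∀ i : ℕ, (i : ℤ) < v i
  sum_injective : Function.Injective fun F : Finset ℕ => ∑ i ∈ F, v i

theorem w_injective : Function.Injective w := fun a b h => by
  have h1 : (2 : ℕ) ^ 2 ^ a = 2 ^ 2 ^ b := by
    simp only [w] at h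
    exact_mod_cast h
  exact Nat.pow_right_injective le_rfl (Nat.pow_right_injective le_rfl h1)

theorem isLacunary_w_comp {m : ℕ → ℕ} (hm : StrictMono m) : IsLacunary (w ∘ m) where
  dvd i j hij := pow_dvd_pow 2 (Nat.pow_le_pow_right two_pos (hm.monotone hij))
  lt i := by
    have h1 : m i < 2 ^ m i := Nat.lt_two_pow_self
    have h2 : 2 ^ m i < 2 ^ 2 ^ m i := Nat.lt_two_pow_self
    have h3 : i < 2 ^ 2 ^ m i := ((hm.le_apply).trans_lt h1).trans h2
    simp only [Function.comp_apply, w]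
    exact_mod_cast h3
  sum_injective := by
    -- The terms are distinct powers of `2`, so uniqueness of binary expansions applies.
    have hinj : Function.Injective fun i => 2 ^ m i :=
      (Nat.pow_right_injective le_rfl).comp hm.injective
    have key : ∀ F : Finset ℕ, ∑ i ∈ F, (w ∘ m) i =
        ((∑ k ∈ F.map ⟨fun i => 2 ^ m i, hinj⟩, 2 ^ k : ℕ) : ℤ) := fun F => by
      rw [Finset.sum_map]
      push_cast
      rfl
    intro F G h
    simp only [key] at h
    exact Finset.map_injective _ (Finset.geomSum_injective le_rfl (by exact_mod_cast h))

theorem self_mem_basicNhd (a : ℕ) (s : ℤ) (α : ℕ) : (a, s) ∈ basicNhd v a s α :=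
  ⟨∅, by simp, by simp, by simp⟩

theorem basicNhd_antitone (a : ℕ) (s : ℤ) : Antitone (basicNhd v a s) := by
  rintro α β h p ⟨F, h1, h2⟩
  exact ⟨F, fun i hi => h.trans (h1 i hi), h2⟩

/-- Indices from `γ` on are disjoint from `F`, so the two index sets can be merged. -/
theorem basicNhd_subset_of_disjoint {a α γ : ℕ} {s : ℤ} {p : ℕ × ℤ} {F : Finset ℕ}
    (h1 : ∀ i ∈ F, α ≤ i) (h2 : p.1 + F.card = a) (h3 : p.2 = s + ∑ i ∈ F, v i)
    (hα : α ≤ γ) (hγ : ∀ i ∈ F, i < γ) : basicNhd v p.1 p.2 γ ⊆ basicNhd v a s α := by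
  rintro q ⟨G, g1, g2, g3⟩
  have hd : Disjoint F G := Finset.disjoint_left.2 fun i hF hG =>
    absurd (hγ i hF) (not_lt.2 (g1 i hG))
  refine ⟨F ∪ G, fun i hi => ?_, ?_, ?_⟩
  · rcases Finset.mem_union.1 hi with h | h
    · exact h1 i h
    · exact hα.trans (g1 i h)
  · rw [Finset.card_union_of_disjoint hd]; omega
  · rw [Finset.sum_union hd, g3, h3]; ring

theorem exists_basicNhd_subset {a α : ℕ} {s : ℤ} {p : ℕ × ℤ} (hp : p ∈ basicNhd v a s α) :
    ∃ γ, basicNhd v p.1 p.2 γ ⊆ basicNhd v a s α := by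
  obtain ⟨F, h1, h2, h3⟩ := hp
  refine ⟨max α (F.sup id + 1), basicNhd_subset_of_disjoint h1 h2 h3 (le_max_left _ _)
    fun i hi => ?_⟩
  exact (Nat.lt_succ_of_le (Finset.le_sup (f := id) hi)).trans_le (le_max_right _ _)

theorem isTopologicalBasis_basicNhds (v : ℕ → ℤ) :
    @TopologicalSpace.IsTopologicalBasis _ (sigma v) (basicNhds v) := by
  let _ := sigma v
  refine ⟨?_, ?_, rfl⟩
  · rintro _ ⟨a, s, α, rfl⟩ _ ⟨b, t, β, rfl⟩ p ⟨h1, h2⟩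
    obtain ⟨γ, hγ⟩ := exists_basicNhd_subset h1
    obtain ⟨δ, hδ⟩ := exists_basicNhd_subset h2
    refine ⟨_, ⟨p.1, p.2, max γ δ, rfl⟩, self_mem_basicNhd _ _ _, subset_inter ?_ ?_⟩
    · exact (basicNhd_antitone _ _ (le_max_left _ _)).trans hγ
    · exact (basicNhd_antitone _ _ (le_max_right _ _)).trans hδ
  · exact eq_univ_of_forall fun p => ⟨_, ⟨p.1, p.2, 0, rfl⟩, self_mem_basicNhd _ _ _⟩

theorem isOpen_basicNhd (v : ℕ → ℤ) (a : ℕ) (s : ℤ) (α : ℕ) :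
    IsOpen[sigma v] (basicNhd v a s α) :=
  TopologicalSpace.isOpen_generateFrom_of_mem ⟨a, s, α, rfl⟩

theorem hasAntitoneBasis_nhds_sigma (v : ℕ → ℤ) (p : ℕ × ℤ) :
    (@nhds _ (sigma v) p).HasAntitoneBasis (basicNhd v p.1 p.2) := by
  let _ := sigma v
  refine ⟨⟨fun t => ?_⟩, basicNhd_antitone _ _⟩
  rw [(isTopologicalBasis_basicNhds v).mem_nhds_iff]
  constructor
  · rintro ⟨_, ⟨a, s, α, rfl⟩, hp, ht⟩
    obtain ⟨γ, hγ⟩ := exists_basicNhd_subset hp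
    exact ⟨γ, trivial, hγ.trans ht⟩
  · rintro ⟨γ, -, hγ⟩
    exact ⟨_, ⟨_, _, γ, rfl⟩, self_mem_basicNhd _ _ _, hγ⟩

theorem t2Space_sigma (hv : IsLacunary v) : @T2Space _ (sigma v) := by
  let _ := sigma v
  refine ⟨fun p q hpq => ?_⟩
  have hmem : ∀ p : ℕ × ℤ, ∀ α, p ∈ basicNhd v p.1 p.2 α := fun p α => self_mem_basicNhd _ _ _
  -- With `N = |p.2 - q.2|`, a common point would make `v N > N` divide `p.2 - q.2`, forcing it to
  -- be `0`; the index sets then coincide.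
  refine ⟨_, _, isOpen_basicNhd v p.1 p.2 (p.2 - q.2).natAbs,
    isOpen_basicNhd v q.1 q.2 (p.2 - q.2).natAbs, hmem _ _, hmem _ _, ?_⟩
  rw [Set.disjoint_left]
  rintro x ⟨F, f1, f2, f3⟩ ⟨G, g1, g2, g3⟩
  have hd : ∀ H : Finset ℕ, (∀ i ∈ H, (p.2 - q.2).natAbs ≤ i) →
      v (p.2 - q.2).natAbs ∣ ∑ i ∈ H, v i := fun H hH =>
    Finset.dvd_sum fun i hi => hv.dvd _ _ (hH i hi)
  have h0 : p.2 - q.2 = 0 := by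
    refine Int.eq_zero_of_abs_lt_dvd (m := v (p.2 - q.2).natAbs) ?_ ?_
    · have : p.2 - q.2 = ∑ i ∈ G, v i - ∑ i ∈ F, v i := by linarith
      conv_rhs => rw [this]
      exact dvd_sub (hd G g1) (hd F f1)
    · have := hv.lt (p.2 - q.2).natAbs
      rwa [Int.natCast_natAbs] at this
  have hFG : F = G := hv.sum_injective (by simp only; linarith)
  subst hFG
  exact hpq (Prod.ext (by omega) (by omega))

theorem basicNhd_zero (s : ℤ) (α : ℕ) : basicNhd v 0 s α = {(0, s)} := by
  refine Subset.antisymm ?_ (singleton_subset_iff.2 (self_mem_basicNhd _ _ _))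
  rintro p ⟨F, -, h2, h3⟩
  have hF : F = ∅ := Finset.card_eq_zero.1 (by omega)
  subst hF
  exact Prod.ext (by simpa using h2) (by simpa using h3)

/-- Split off the least index of `F` when it is below `β`. Only finitely many sets of lower level
arise, which drives the compactness induction. -/
theorem basicNhd_succ_subset (a : ℕ) (s : ℤ) (α β : ℕ) :
    basicNhd v (a + 1) s α ⊆
      basicNhd v (a + 1) s β ∪ ⋃ i ∈ Finset.Ico α β, basicNhd v a (s + v i) (i + 1) := by
  rintro p ⟨F, h1, h2, h3⟩
  by_cases h : ∀ i ∈ F, β ≤ i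
  · exact Or.inl ⟨F, h, h2, h3⟩
  · push Not at h
    obtain ⟨j, hj, hjβ⟩ := h
    have hne : F.Nonempty := ⟨j, hj⟩
    have hmin := F.min'_mem hne
    refine Or.inr (mem_iUnion₂.2 ⟨F.min' hne, Finset.mem_Ico.2 ⟨h1 _ hmin,
      (F.min'_le j hj).trans_lt hjβ⟩, F.erase (F.min' hne), fun i hi => ?_, ?_, ?_⟩)
    · exact F.min'_lt_of_mem_erase_min' hne hi
    · rw [Finset.card_erase_of_mem hmin]
      have := Finset.card_pos.2 hne
      omega
    · rw [h3, ← Finset.add_sum_erase _ _ hmin]; ring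

theorem basicNhd_add_subset {a i α : ℕ} {s : ℤ} (hi : α ≤ i) :
    basicNhd v a (s + v i) (i + 1) ⊆ basicNhd v (a + 1) s α :=
  basicNhd_subset_of_disjoint (p := (a, s + v i)) (F := {i}) (by simpa) (by simp) (by simp)
    (by omega) (by simp)

theorem isCompact_basicNhd (v : ℕ → ℤ) (a : ℕ) (s : ℤ) (α : ℕ) :
    @IsCompact _ (sigma v) (basicNhd v a s α) := by
  let _ := sigma v
  induction a generalizing s α with
  | zero => rw [basicNhd_zero]; exact isCompact_singleton
  | succ a ih =>
    refine isCompact_of_finite_subcover fun {ι} V hV hcov => ?_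
    obtain ⟨k, hk⟩ := mem_iUnion.1 (hcov (self_mem_basicNhd _ _ _))
    obtain ⟨β, -, hβ⟩ := (hasAntitoneBasis_nhds_sigma v _).toHasBasis.mem_iff.1
      ((hV k).mem_nhds hk)
    have hK : IsCompact (⋃ i ∈ Finset.Ico α β, basicNhd v a (s + v i) (i + 1)) :=
      (Finset.Ico α β).isCompact_biUnion fun i _ => ih _ _
    obtain ⟨T, hT⟩ := hK.elim_finite_subcover V hV (iUnion₂_subset fun i hi =>
      (basicNhd_add_subset (Finset.mem_Ico.1 hi).1).trans hcov)
    classical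
    refine ⟨insert k T, (basicNhd_succ_subset a s α β).trans (union_subset ?_ ?_)⟩
    · exact hβ.trans (subset_biUnion_of_mem (u := V) (Finset.mem_insert_self k T))
    · exact hT.trans (biUnion_subset_biUnion_left fun i hi => Finset.mem_insert_of_mem hi)

theorem locallyCompactSpace_sigma (v : ℕ → ℤ) : @LocallyCompactSpace _ (sigma v) := by
  let _ := sigma v
  exact .of_hasBasis (fun p => (hasAntitoneBasis_nhds_sigma v p).toHasBasis)
    fun p α _ => isCompact_basicNhd v _ _ _

theorem not_discreteTopology_sigma (v : ℕ → ℤ) : ¬ @DiscreteTopology _ (sigma v) := by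
  let _ := sigma v
  intro h
  have h1 : ({(1, 0)} : Set (ℕ × ℤ)) ∈ 𝓝 (1, 0) := (isOpen_discrete _).mem_nhds rfl
  obtain ⟨α, -, hα⟩ := (hasAntitoneBasis_nhds_sigma v _).toHasBasis.mem_iff.1 h1
  have h2 : ((0, v α) : ℕ × ℤ) ∈ basicNhd v 1 0 α := ⟨{α}, by simp, by simp, by simp⟩
  simpa using hα h2

theorem continuous_add_left_sigma (v : ℕ → ℤ) (t : ℕ × ℤ) :
    Continuous[sigma v, sigma v] (fun x => t + x) := by
  let _ := sigma v
  refine continuous_iff_continuousAt.2 fun x => ?_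
  refine ((hasAntitoneBasis_nhds_sigma v x).toHasBasis.tendsto_iff
    (hasAntitoneBasis_nhds_sigma v (t + x)).toHasBasis).2 fun α _ => ⟨α, trivial, ?_⟩
  rintro p ⟨F, h1, h2, h3⟩
  refine ⟨F, h1, ?_, ?_⟩
  · simp only [Prod.fst_add]; omega
  · simp only [Prod.snd_add]; omega

/-- Gives properness of translations. Truncation in `a - t.1` is harmless: if `a < t.1` the preimage
is empty. -/
theorem preimage_add_left_basicNhd (t : ℕ × ℤ) (a : ℕ) (s : ℤ) (α : ℕ) :
    (fun x => t + x) ⁻¹' basicNhd v a s α ⊆ basicNhd v (a - t.1) (s - t.2) α := by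
  rintro p ⟨F, h1, h2, h3⟩
  simp only [Prod.fst_add, Prod.snd_add] at h2 h3
  exact ⟨F, h1, by omega, by omega⟩

theorem tendsto_add_left_cocompact_sigma (v : ℕ → ℤ) (t : ℕ × ℤ) :
    Tendsto (fun x => t + x) (@cocompact _ (sigma v)) (@cocompact _ (sigma v)) := by
  let _ := sigma v
  refine hasBasis_cocompact.tendsto_right_iff.2 fun K hK => ?_
  obtain ⟨T, hT⟩ := hK.elim_nhds_subcover (fun p => basicNhd v p.1 p.2 0)
    fun p _ => (hasAntitoneBasis_nhds_sigma v p).toHasBasis.mem_of_mem trivial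
  have hc : IsCompact (⋃ p ∈ T, basicNhd v (p.1 - t.1) (p.2 - t.2) 0) :=
    T.isCompact_biUnion fun i _ => isCompact_basicNhd v _ _ _
  filter_upwards [hc.compl_mem_cocompact] with x hx hxK
  obtain ⟨p, hp, h⟩ := mem_iUnion₂.1 (hT.2 hxK)
  exact hx (mem_iUnion₂.2 ⟨p, hp, preimage_add_left_basicNhd t _ _ _ h⟩)

theorem isSemitopological_sigma (v : ℕ → ℤ) : IsSemitopological (sigma v) := fun t =>
  ⟨continuous_add_left_sigma v t, by
    simpa only [add_comm] using continuous_add_left_sigma v t⟩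

theorem fst_lt_of_mem_basicNhd {p q : ℕ × ℤ} {α : ℕ} (h : q ∈ basicNhd v p.1 p.2 α)
    (hne : q ≠ p) : q.1 < p.1 := by
  obtain ⟨F, h1, h2, h3⟩ := h
  rcases F.eq_empty_or_nonempty with rfl | hF
  · exact (hne (Prod.ext (by simpa using h2) (by simpa using h3))).elim
  · have := Finset.card_pos.2 hF
    omega

theorem isHopfPredual_C0_sigma (hv : IsLacunary v) : IsHopfPredual (C0 (sigma v)) := by
  refine (isHopfPredual_iff _).2 ⟨⟨@isClosed_C0 _ _ (sigma v), fun f hf a => ?_, fun f hf a => ?_,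
    ?_⟩, fun f hf g hg => @pointwiseMul_mem_C0 _ _ (sigma v) _ _ hf.1 hg⟩
  · exact comp_conv_mem_C0 (continuous_add_left_sigma v) (tendsto_add_left_cocompact_sigma v) hf a
  · rw [conv_flip]
    exact comp_conv_mem_C0 (continuous_add_left_sigma v) (tendsto_add_left_cocompact_sigma v) hf a
  · exact @bijective_toDual_C0 _ _ (sigma v) (t2Space_sigma hv) _
      (hasAntitoneBasis_nhds_sigma v) (fun p => isOpen_basicNhd v p.1 p.2)
      (fun p => isCompact_basicNhd v p.1 p.2) Prod.fst
      fun p n q hq hne => fst_lt_of_mem_basicNhd hq hne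

/-- The set `basicNhd v 1 0 0` is `(1, 0)` together with all `(0, v j)`. Its indicator must be
continuous for `sigma u`, where `(0, u i)` converges to `(1, 0)`. -/
theorem eventually_mem_range_of_C0_le {u : ℕ → ℤ} (hv : IsLacunary v)
    (h : C0 (sigma v) ≤ C0 (sigma u)) : ∀ᶠ i in atTop, u i ∈ range v := by
  have hmem : indic (basicNhd v 1 0 0) ∈ C0 (sigma v) := by
    let _ := sigma v
    have := t2Space_sigma hv
    have hc : IsCompact (basicNhd v 1 0 0) := isCompact_basicNhd v 1 0 0
    exact indic_mem_C0 ⟨hc.isClosed, isOpen_basicNhd v 1 0 0⟩ hc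
  have hcont := (h hmem).1
  let _ := sigma u
  have hne : ∀ᶠ x in 𝓝 ((1, 0) : ℕ × ℤ), indic (basicNhd v 1 0 0) (delta x) ≠ 0 := by
    refine (hcont.tendsto _).eventually_ne ?_
    rw [indic_delta_of_mem (self_mem_basicNhd _ _ _)]
    exact one_ne_zero
  obtain ⟨α, -, hα⟩ := (hasAntitoneBasis_nhds_sigma u _).toHasBasis.mem_iff.1 hne
  filter_upwards [eventually_ge_atTop α] with i hi
  have h1 : ((0, u i) : ℕ × ℤ) ∈ basicNhd u 1 0 α := ⟨{i}, by simpa, by simp, by simp⟩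
  have h2 : ((0, u i) : ℕ × ℤ) ∈ basicNhd v 1 0 0 := by
    by_contra hn
    exact hα h1 (indic_delta_of_notMem hn)
  obtain ⟨F, -, hF, hs⟩ := h2
  obtain ⟨j, rfl⟩ := Finset.card_eq_one.1 (by simpa using hF)
  exact ⟨j, by simpa using hs.symm⟩

end Sigma

/-! ### An almost disjoint family of sequences. -/

section Cardinality

/-- The integers whose binary expansions are `1` followed by the initial segments of `x`. -/
def prefixSeq (x : ℕ → Bool) : ℕ → ℕ
  | 0 => 1
  | n + 1 => 2 * prefixSeq x n + (x n).toNat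

theorem prefixSeq_pos (x : ℕ → Bool) (n : ℕ) : 0 < prefixSeq x n := by
  induction n with
  | zero => simp [prefixSeq]
  | succ n ih => simp only [prefixSeq]; omega

theorem prefixSeq_strictMono (x : ℕ → Bool) : StrictMono (prefixSeq x) :=
  strictMono_nat_of_lt_succ fun n => by
    have := prefixSeq_pos x n
    simp only [prefixSeq]; omega

/-- The leading `1` makes the binary expansion remember the length of the prefix as well as its
digits. -/
theorem prefixSeq_eq {x y : ℕ → Bool} {i j : ℕ} (h : prefixSeq x i = prefixSeq y j) :
    i = j ∧ ∀ k < i, x k = y k := by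
  induction i generalizing j with
  | zero =>
    cases j with
    | zero => simp
    | succ j =>
      have := prefixSeq_pos y j
      simp only [prefixSeq] at h
      omega
  | succ i ih =>
    cases j with
    | zero =>
      have := prefixSeq_pos x i
      simp only [prefixSeq] at h
      omega
    | succ j =>
      simp only [prefixSeq] at h
      have hx := Bool.toNat_le (x i)
      have hy := Bool.toNat_le (y j)
      obtain ⟨rfl, hxy⟩ := ih (j := j) (by omega)
      refine ⟨rfl, fun k hk => ?_⟩
      rcases Nat.lt_succ_iff_lt_or_eq.1 hk with hk | rfl
      · exact hxy k hk
      · have : (x k).toNat = (y k).toNat := by omega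
        cases hxk : x k <;> cases hyk : y k <;> simp_all

theorem C0_sigma_prefixSeq_injective :
    Function.Injective fun x : ℕ → Bool => C0 (sigma (w ∘ prefixSeq x)) := by
  intro x y hxy
  have h := eventually_mem_range_of_C0_le (isLacunary_w_comp (prefixSeq_strictMono y))
    (le_of_eq hxy.symm)
  funext k
  -- A shared prefix of length greater than `k` shows that `x` and `y` agree at `k`.
  obtain ⟨i, ⟨j, hj⟩, hi⟩ := (h.and (eventually_gt_atTop k)).exists
  exact (prefixSeq_eq (w_injective hj.symm)).2 k hi

end Cardinality

end SemigroupPredual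

open SemigroupPredual in
theorem mainTheorem5 :
    (∀ m : ℕ → ℕ, StrictMono m → 1 ≤ m 0 →
      @TopologicalSpace.IsTopologicalBasis _ (sigma (w ∘ m)) (basicNhds (w ∘ m)) ∧
      @T2Space _ (sigma (w ∘ m)) ∧
      @LocallyCompactSpace _ (sigma (w ∘ m)) ∧
      ¬ @DiscreteTopology _ (sigma (w ∘ m)) ∧
      IsSemitopological (sigma (w ∘ m)) ∧
      IsHopfPredual (C0 (sigma (w ∘ m)))) ∧
    Cardinal.mk {E : Submodule ℂ (StrongDual ℂ ℓ¹(ℕ × ℤ, ℂ)) |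
      ∃ m : ℕ → ℕ, StrictMono m ∧ 1 ≤ m 0 ∧ E = C0 (sigma (w ∘ m))} = Cardinal.continuum := by
  refine ⟨fun m hm _ => ⟨isTopologicalBasis_basicNhds _, t2Space_sigma (isLacunary_w_comp hm),
    locallyCompactSpace_sigma _, not_discreteTopology_sigma _, isSemitopological_sigma _,
    isHopfPredual_C0_sigma (isLacunary_w_comp hm)⟩, le_antisymm ?_ ?_⟩
  · have hsub : {E : Submodule ℂ (StrongDual ℂ ℓ¹(ℕ × ℤ, ℂ)) |
        ∃ m : ℕ → ℕ, StrictMono m ∧ 1 ≤ m 0 ∧ E = C0 (sigma (w ∘ m))} ⊆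
        range fun m : ℕ → ℕ => C0 (sigma (w ∘ m)) := by
      rintro _ ⟨m, -, -, rfl⟩
      exact ⟨m, rfl⟩
    refine (Cardinal.mk_le_mk_of_subset hsub).trans (Cardinal.mk_range_le.trans ?_)
    simp
  · have hmem : ∀ x : ℕ → Bool, C0 (sigma (w ∘ prefixSeq x)) ∈
        {E : Submodule ℂ (StrongDual ℂ ℓ¹(ℕ × ℤ, ℂ)) |
          ∃ m : ℕ → ℕ, StrictMono m ∧ 1 ≤ m 0 ∧ E = C0 (sigma (w ∘ m))} := fun x =>
      ⟨prefixSeq x, prefixSeq_strictMono x, le_rfl, rfl⟩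
    have := Cardinal.mk_le_of_injective (f := fun x : ℕ → Bool => (⟨_, hmem x⟩ :
      {E : Submodule ℂ (StrongDual ℂ ℓ¹(ℕ × ℤ, ℂ)) |
          ∃ m : ℕ → ℕ, StrictMono m ∧ 1 ≤ m 0 ∧ E = C0 (sigma (w ∘ m))}))
      fun x y h => C0_sigma_prefixSeq_injective (Subtype.ext_iff.1 h)
    rwa [Cardinal.mk_arrow, Cardinal.mk_bool, Cardinal.mk_nat, Cardinal.lift_aleph0,
      Cardinal.lift_ofNat, Cardinal.two_power_aleph0] at this
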